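/- Let $W$ be a finite reflection group with a reduced root system $\Phi$ spanning a real vector space $V$ (not necessarily crystallographic), i.e. $W$ is generated by the reflections $s_\alpha$ in the roots $\alpha$ of $\Phi$. Fix a system of simple roots with corresponding simple reflections $s_1,\dots,s_n$, let $\ell$ be the resulting length function, and let $\le$ be the Bruhat order on $W$, that is, the reflexive transitive closure of the relation $u < us_\alpha$ for roots $\alpha$ with $\ell(u)<\ell(us_\alpha)$. For $I\subseteq\{1,\dots,n\}$ let $W_I=\langle s_i : i\in I\rangle$. For $B,B'\in W/W_I$ write $B\le B'$ if $u\le u'$ for some $u\in B$ and $u'\in B'$, and for $w\in W$ write $B\le^w B'$ if $w^{-1}B\le w^{-1}B'$. A subset $M\subseteq W/W_I$ is a *Coxeter matroid* if for every $w\in W$ it has a unique $\le^w$-minimal element, which is denoted $\min^w(M)$. The $\mathcal G$-invariant of a Coxeter matroid $M$ is $$\mathcal G(M)=\sum_{w\in W}U_{w^{-1}\cdot\min^w(M)}\in\mathbb Q^{W/W_I},$$ where $\{U_B\}_{B\in W/W_I}$ is the standard basis of $\mathbb Q^{W/W_I}$. **Lemma.** Let $B\in W/W_I$ and let $\Omega_B=\{B'\in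 W/W_I : B\le B'\}$. Then $\Omega_B$ is a Coxeter matroid (the Coxeter Schubert matroid of $B$), and there exist scalars $c^B_{B'}\in\mathbb Q$ for $B'\le B$ such that $$\mathcal G(\Omega_B)=\sum_{B'\le B}c^B_{B'}\,U_{B'},\qquad\text{where } c^B_B\ne 0.$$ Moreover, $w^{-1}\cdot\min^w(\Omega_B)\le B$ for all $w\in W$. -/

import Mathlib

noncomputable section

namespace CoxeterSchubert

variable {ι V N : Type*} [AddCommGroup V] [Module ℝ V] [AddCommGroup N] [Module ℝ N]

/-- The group generated by the reflections of a finite spanning root system is finite, since it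
acts faithfully on the finite set of roots. -/
theorem finite_weylGroup (P : RootPairing ι ℝ V N) [Finite ι] [P.IsRootSystem] :
    Finite P.weylGroup := by
  have hinj : Function.Injective (fun w : P.weylGroup => fun i => w.1.indexEquiv i) := by
    intro g h hgh
    apply Subtype.ext
    apply RootPairing.Equiv.weightHom_injective P
    apply LinearEquiv.toLinearMap_injective
    apply LinearMap.ext_on_range
      (RootPairing.IsRootSystem.span_root_eq_top (P := P))
    intro i
    have h1 := RootPairing.Equiv.root_indexEquiv_eq_smul (P := P) i g.1
    have h2 := RootPairing.Equiv.root_indexEquiv_eq_smul (P := P) i h.1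
    have h3 : g.1.indexEquiv i = h.1.indexEquiv i := congrFun hgh i
    rw [h3] at h1
    exact h1.symm.trans h2
  exact Finite.of_injective _ hinj

instance instFintypeWeylGroup (P : RootPairing ι ℝ V N) [Finite ι] [P.IsRootSystem] : Fintype P.weylGroup :=
  haveI := finite_weylGroup P
  Fintype.ofFinite _

instance instFintypeQuotient (P : RootPairing ι ℝ V N) [Finite ι] [P.IsRootSystem] (H : Subgroup P.weylGroup) :
    Fintype (P.weylGroup ⧸ H) :=
  haveI := finite_weylGroup P
  Fintype.ofFinite _

/-- A simple system of a (not necessarily crystallographic) real root system: a linearly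
independent set of roots such that every root is a linear combination of them with coefficients
all of the same sign. The roots with nonnegative coefficients form the positive system. -/
structure SimpleSystem (P : RootPairing ι ℝ V N) where
  /-- The indices of the simple roots. -/
  support : Finset ι
  linearIndepOn_root : LinearIndepOn ℝ P.root support
  root_nonneg_or_nonpos (i : ι) : ∃ c : ι → ℝ,
    P.root i = ∑ j ∈ support, c j • P.root j ∧
      ((∀ j ∈ support, 0 ≤ c j) ∨ (∀ j ∈ support, c j ≤ 0))

namespace SimpleSystem

variable {P : RootPairing ι ℝ V N} (Δ : SimpleSystem P)

/-- The simple reflections, as elements of the reflection group. -/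
def simpleReflection (i : Δ.support) : P.weylGroup :=
  RootPairing.weylGroup.ofIdx P i

/-- The length of `w`: the least number of factors in a product of simple reflections
equal to `w`. -/
def length (w : P.weylGroup) : ℕ :=
  sInf {k | ∃ l : List Δ.support, l.length = k ∧ (l.map Δ.simpleReflection).prod = w}

/-- The Bruhat order on the reflection group: the reflexive transitive closure of the relation
`u < u t`, where `t` is a reflection in a root and the length of `u t` exceeds that of `u`. -/
def BruhatLE (u v : P.weylGroup) : Prop :=
  Relation.ReflTransGen
    (fun x y => ∃ i : ι, y = x * RootPairing.weylGroup.ofIdx P i ∧ Δ.length x < Δ.length y) u v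

/-- The parabolic subgroup `W_I` generated by the simple reflections in `I`. -/
def parabolic (I : Set Δ.support) : Subgroup P.weylGroup :=
  Subgroup.closure (Δ.simpleReflection '' I)

/-- The set `W / W_I` of left cosets. -/
abbrev Cosets (I : Set Δ.support) : Type _ := P.weylGroup ⧸ Δ.parabolic I

variable {I : Set Δ.support}

/-- The Bruhat order on `W / W_I`. -/
def CosetLE (B B' : Δ.Cosets I) : Prop :=
  ∃ u u' : P.weylGroup, (u : Δ.Cosets I) = B ∧ (u' : Δ.Cosets I) = B' ∧ Δ.BruhatLE u u'

/-- The twisted order `B ≤^w B'`, meaning `w⁻¹ B ≤ w⁻¹ B'`. -/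
def CosetLETwist (w : P.weylGroup) (B B' : Δ.Cosets I) : Prop :=
  Δ.CosetLE (w⁻¹ • B) (w⁻¹ • B')

/-- `B` is a minimal element of `M` with respect to `≤^w`. -/
def IsMinimalIn (w : P.weylGroup) (M : Set (Δ.Cosets I)) (B : Δ.Cosets I) : Prop :=
  B ∈ M ∧ ∀ B' ∈ M, Δ.CosetLETwist w B' B → B' = B

/-- `M` is a Coxeter matroid: for every `w` it has a unique `≤^w`-minimal element. -/
def IsCoxeterMatroid (M : Set (Δ.Cosets I)) : Prop :=
  ∀ w : P.weylGroup, ∃! B, Δ.IsMinimalIn w M B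

/-- The unique `≤^w`-minimal element `min^w(M)` of a Coxeter matroid. -/
def minElt {M : Set (Δ.Cosets I)} (hM : Δ.IsCoxeterMatroid M) (w : P.weylGroup) : Δ.Cosets I :=
  (hM w).choose

open Classical in
/-- The standard basis vector `U_B` of `ℚ^(W / W_I)`. -/
def basisVec (B : Δ.Cosets I) : Δ.Cosets I → ℚ := Pi.single B 1

/-- The `𝒢`-invariant of a Coxeter matroid, the sum of `U_{w⁻¹ min^w(M)}` over all `w`. -/
def gInvariant [Finite ι] [P.IsRootSystem] {M : Set (Δ.Cosets I)} (hM : Δ.IsCoxeterMatroid M) :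
    Δ.Cosets I → ℚ :=
  ∑ w : P.weylGroup, Δ.basisVec (w⁻¹ • Δ.minElt hM w)

/-- The underlying set `{B' | B ≤ B'}` of the Coxeter Schubert matroid of `B`. -/
def schubert (B : Δ.Cosets I) : Set (Δ.Cosets I) := {B' | Δ.CosetLE B B'}

open Classical in
/-- The finite set of all `B' ≤ B` in `W / W_I`. -/
def lowerCosets [Finite ι] [P.IsRootSystem] (B : Δ.Cosets I) : Finset (Δ.Cosets I) :=
  Finset.univ.filter fun B' => Δ.CosetLE B' B

end SimpleSystem

end CoxeterSchubert

end

/-! Everything reduces to one statement about W: for all u and a, the translate a·{v : u ≤ v} has a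
Bruhat-least element (`exists_least_mul`). A minimal-length representative m of B satisfies B ≤ xW_I
iff m ≤ x (`exists_bruhatLE_rep`), so with a = w⁻¹ the least element projects to the ≤^w-least coset
of Ω_B, and antisymmetry makes it the only minimal one.

Least elements come by descending induction on ℓ(u). If su > u, the lifting property writes {v ≥ u}
as {v ≥ su} ∪ s{v ≥ su}; by `exists_mul_bruhatLE_mul` the longer of a and as has the lower translate
of {v ≥ su}, so its least element serves for u. The same lemma, applied to 1 ≤ w⁻¹, yields
w⁻¹·min^w(Ω_B) ≤ B. Finally 𝒢(Ω_B) has nonnegative coordinates, and w = 1 contributes U_B. -/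

noncomputable section

namespace CoxeterSchubert

variable {ι V N : Type*} [AddCommGroup V] [Module ℝ V] [AddCommGroup N] [Module ℝ N]

/-! ### Reflections and the invariant form. -/

section Reflections

variable (P : RootPairing ι ℝ V N)

/-- The reflection in the `i`-th root, as an element of the reflection group. -/
abbrev refl (i : ι) : P.weylGroup := RootPairing.weylGroup.ofIdx P i

lemma root_smul (g : P.weylGroup) (i : ι) : P.root (g • i) = g • P.root i :=
  (P.weylGroup_apply_root g i).symm

lemma smul_smul_real (g : P.weylGroup) (r : ℝ) (x : V) : g • (r • x) = r • (g • x) :=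
  smul_comm g.1 r x

lemma refl_smul (i : ι) (x : V) : refl P i • x = x - P.coroot' i x • P.root i := rfl

lemma refl_smul_root_self (i : ι) : refl P i • P.root i = -P.root i :=
  P.reflection_apply_self i

@[simp]
lemma refl_mul_self (i : ι) : refl P i * refl P i = 1 := by
  apply Subtype.ext
  change RootPairing.Equiv.reflection P i * RootPairing.Equiv.reflection P i = 1
  rw [mul_eq_one_iff_inv_eq, RootPairing.Equiv.reflection_inv]

@[simp]
lemma refl_inv (i : ι) : (refl P i)⁻¹ = refl P i :=
  inv_eq_of_mul_eq_one_left (refl_mul_self P i)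

@[simp]
lemma mul_refl_mul_refl (w : P.weylGroup) (i : ι) : w * refl P i * refl P i = w := by
  rw [mul_assoc, refl_mul_self, mul_one]

@[simp]
lemma refl_mul_refl_mul (w : P.weylGroup) (i : ι) : refl P i * (refl P i * w) = w := by
  rw [← mul_assoc, refl_mul_self, one_mul]

variable {P} in
lemma weylGroup_ext {g h : P.weylGroup} (H : ∀ x : V, g • x = h • x) : g = h := by
  apply Subtype.ext
  apply RootPairing.Equiv.weightHom_injective P
  apply LinearEquiv.toLinearMap_injective
  exact LinearMap.ext H

/-- The reflection group preserves a symmetric bilinear form, positive on roots, whose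
orthogonal reflections are the reflections of the root system. -/
lemma exists_invariantForm [Finite ι] : ∃ F : LinearMap.BilinForm ℝ V,
    (∀ i, 0 < F (P.root i) (P.root i)) ∧
    (∀ (g : P.weylGroup) (x y : V), F (g • x) (g • y) = F x y) ∧
    ∀ (i : ι) (x : V), P.coroot' i x * F (P.root i) (P.root i) = 2 * F x (P.root i) := by
  have := Fintype.ofFinite ι
  refine ⟨P.RootForm, fun i => ?_, fun g x y => ?_, fun i x => ?_⟩
  · exact P.rootForm_pos_of_ne_zero (Submodule.subset_span ⟨i, rfl⟩) (P.ne_zero i)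
  · obtain ⟨g, hg⟩ := g
    induction hg using RootPairing.weylGroup.induction generalizing x y with
    | mem i => exact P.rootForm_reflection_reflection_apply i x y
    | one => rfl
    | mul g₁ g₂ hg₁ hg₂ h₁ h₂ => exact (h₁ _ _).trans (h₂ x y)
  · have h := P.rootForm_reflection_reflection_apply i x (P.root i)
    rw [P.reflection_apply_self, P.reflection_apply] at h
    simp only [map_sub, map_smul, map_neg, LinearMap.sub_apply, LinearMap.smul_apply,
      smul_eq_mul] at h
    linarith

variable {P}

/-- The invariant form recovers a coroot from its root, scaling it by r⁻¹. With r = -1 this allows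
replacing a root by its negative. -/
lemma refl_eq_of_root_eq_smul [Finite ι] {i j : ι} {r : ℝ} (hr : r ≠ 0)
    (h : P.root j = r • P.root i) : refl P j = refl P i := by
  obtain ⟨F, hpos, -, hF⟩ := exists_invariantForm P
  apply weylGroup_ext
  intro x
  rw [refl_smul, refl_smul]
  have hi := hF i x
  have hj := hF j x
  rw [h] at hj ⊢
  simp only [map_smul, LinearMap.smul_apply, smul_eq_mul] at hj
  have hp := (hpos i).ne'
  rw [smul_smul]
  congr 2
  have : (r * (F (P.root i)) (P.root i)) * (P.coroot' j x * r)
      = (r * (F (P.root i)) (P.root i)) * (P.coroot' i x) := by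
    linear_combination hj - r * hi
  exact mul_left_cancel₀ (mul_ne_zero hr hp) this

lemma refl_smul_index [Finite ι] (g : P.weylGroup) (i : ι) :
    refl P (g • i) = g * refl P i * g⁻¹ := by
  obtain ⟨F, hpos, hinv, hF⟩ := exists_invariantForm P
  apply weylGroup_ext
  intro x
  obtain ⟨y, rfl⟩ : ∃ y, x = g • y := ⟨g⁻¹ • x, by simp⟩
  rw [mul_smul, mul_smul, inv_smul_smul, refl_smul, refl_smul, smul_sub, smul_smul_real,
    root_smul]
  congr 2
  have h1 := hF (g • i) (g • y)
  rw [root_smul, hinv, hinv, ← hF i y] at h1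
  exact mul_right_cancel₀ (hpos i).ne' h1

lemma mul_refl_smul_index [Finite ι] (g : P.weylGroup) (i : ι) :
    g * refl P i = refl P (g • i) * g := by
  rw [refl_smul_index]; group

end Reflections

/-! ### Simple coordinates and positive roots. -/

namespace SimpleSystem

variable {P : RootPairing ι ℝ V N} (Δ : SimpleSystem P)

/-- The values off the span of the simple roots are arbitrary; this is harmless, since every root
lies in that span. -/
lemma exists_linearMap_root_eq (a : Δ.support → ℝ) :
    ∃ f : V →ₗ[ℝ] ℝ, ∀ j : Δ.support, f (P.root j) = a j := by
  have li : LinearIndependent ℝ fun j : Δ.support => P.root j := Δ.linearIndepOn_root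
  obtain ⟨f, hf⟩ := LinearMap.exists_extend ((Finsupp.linearCombination ℝ a) ∘ₗ li.repr)
  refine ⟨f, fun j => ?_⟩
  have h := LinearMap.congr_fun hf ⟨P.root j, Submodule.subset_span ⟨j, rfl⟩⟩
  rw [LinearMap.comp_apply, LinearMap.comp_apply, li.repr_eq_single j _ rfl] at h
  simpa using h

/-- The linear functional taking the value `1` on every simple root. -/
def height : V →ₗ[ℝ] ℝ := (Δ.exists_linearMap_root_eq 1).choose

@[simp]
lemma height_simple (j : Δ.support) : Δ.height (P.root j) = 1 :=
  (Δ.exists_linearMap_root_eq 1).choose_spec j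

open Classical in
/-- The linear functional dual to the `j`-th simple root. -/
def coord (j : Δ.support) : V →ₗ[ℝ] ℝ := (Δ.exists_linearMap_root_eq (Pi.single j 1)).choose

open Classical in
lemma coord_simple (j k : Δ.support) :
    Δ.coord j (P.root k) = if k = j then 1 else 0 := by
  rw [coord, (Δ.exists_linearMap_root_eq (Pi.single j 1)).choose_spec k, Pi.single_apply]

lemma root_eq_sum (i : ι) : P.root i = ∑ j : Δ.support, Δ.coord j (P.root i) • P.root j := by
  classical
  obtain ⟨c, hc, -⟩ := Δ.root_nonneg_or_nonpos i
  rw [← Finset.sum_coe_sort] at hc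
  have key : ∀ j : Δ.support, Δ.coord j (P.root i) = c j := by
    intro j
    rw [hc]
    simp [coord_simple]
  simp_rw [key]
  exact hc

lemma height_root (i : ι) : Δ.height (P.root i) = ∑ j : Δ.support, Δ.coord j (P.root i) := by
  conv_lhs => rw [Δ.root_eq_sum i]
  simp

lemma coord_nonneg_or_nonpos (i : ι) :
    (∀ j, 0 ≤ Δ.coord j (P.root i)) ∨ (∀ j, Δ.coord j (P.root i) ≤ 0) := by
  classical
  obtain ⟨c, hc, h⟩ := Δ.root_nonneg_or_nonpos i
  rw [← Finset.sum_coe_sort] at hc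
  have key : ∀ j : Δ.support, Δ.coord j (P.root i) = c j := by
    intro j
    rw [hc]
    simp [coord_simple]
  simp_rw [key]
  exact h.imp (fun h j => h j j.2) (fun h j => h j j.2)

lemma height_root_ne_zero (i : ι) : Δ.height (P.root i) ≠ 0 := by
  intro h0
  rw [height_root] at h0
  have hz : ∀ j, Δ.coord j (P.root i) = 0 := by
    rcases Δ.coord_nonneg_or_nonpos i with h | h
    · simpa using (Finset.sum_eq_zero_iff_of_nonneg fun j _ => h j).mp h0
    · simpa using (Finset.sum_eq_zero_iff_of_nonpos fun j _ => h j).mp h0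
  apply P.ne_zero i
  rw [Δ.root_eq_sum i]
  simp [hz]

lemma coord_nonneg {i : ι} (hi : 0 < Δ.height (P.root i)) (j : Δ.support) :
    0 ≤ Δ.coord j (P.root i) := by
  rcases Δ.coord_nonneg_or_nonpos i with h | h
  · exact h j
  · rw [height_root] at hi
    exact absurd hi (not_lt.mpr (Finset.sum_nonpos fun j _ => h j))

lemma height_pos_of_coord_pos {i : ι} {j : Δ.support} (hj : 0 < Δ.coord j (P.root i)) :
    0 < Δ.height (P.root i) := by
  rcases Δ.coord_nonneg_or_nonpos i with h | h
  · rw [height_root]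
    exact Finset.sum_pos' (fun j _ => h j) ⟨j, Finset.mem_univ j, hj⟩
  · exact absurd hj (not_lt.mpr (h j))

lemma simpleReflection_eq (s : Δ.support) : Δ.simpleReflection s = refl P s := rfl

/-- A simple reflection changes the sign of no positive root but its own. -/
lemma height_simple_smul_pos [P.IsReduced] {s : Δ.support} {i : ι}
    (hi : 0 < Δ.height (P.root i)) (hne : P.root i ≠ P.root s) :
    0 < Δ.height (Δ.simpleReflection s • P.root i) := by
  classical
  -- The reflection in s alters only the s-coordinate, so another positive coordinate keeps the root
  -- positive. If there is none, the root is a multiple of the simple root, and reducedness applies.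
  obtain ⟨j, hjs, hj⟩ : ∃ j, j ≠ s ∧ 0 < Δ.coord j (P.root i) := by
    by_contra! H
    have hz : ∀ j, j ≠ s → Δ.coord j (P.root i) = 0 := fun j hj =>
      le_antisymm (H j hj) (Δ.coord_nonneg hi j)
    have hr : P.root i = Δ.coord s (P.root i) • P.root s := by
      conv_lhs => rw [Δ.root_eq_sum i]
      rw [Finset.sum_eq_single s (fun j _ hj => by rw [hz j hj, zero_smul]) (by simp)]
    have hdep : ¬ LinearIndependent ℝ ![P.root i, P.root s] := by
      intro hl
      have := (LinearIndependent.pair_iff.mp hl) 1 (-Δ.coord s (P.root i))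
        (by rw [one_smul, neg_smul, ← hr, add_neg_cancel])
      exact one_ne_zero this.1
    rcases RootPairing.IsReduced.eq_or_eq_neg i (s : ι) hdep with h | h
    · exact hne h
    · rw [h, map_neg, height_simple] at hi
      linarith
  rw [simpleReflection_eq, ← root_smul]
  apply Δ.height_pos_of_coord_pos (j := j)
  rw [root_smul, refl_smul, map_sub, map_smul, coord_simple, if_neg (Ne.symm hjs)]
  simpa using hj

lemma height_eq_zero_lt_or_lt (i : ι) :
    0 < Δ.height (P.root i) ∨ Δ.height (P.root i) < 0 :=
  (Δ.height_root_ne_zero i).lt_or_gt.symm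

lemma height_smul_ne_zero (g : P.weylGroup) (i : ι) : Δ.height (g • P.root i) ≠ 0 := by
  rw [← root_smul]; exact Δ.height_root_ne_zero _

/-! ### Generation by simple reflections, words and length. -/

/-- In a counterexample α of least height, F(α, α) > 0 forces F(α, α_j) > 0 for some simple α_j.
Unless α = α_j, reflecting in α_j gives a lower positive root, whose reflection is conjugate to that
of α. -/
lemma refl_mem_closure_of_height_pos [Finite ι] [P.IsReduced] (i : ι)
    (hi : 0 < Δ.height (P.root i)) :
    refl P i ∈ Subgroup.closure (Set.range Δ.simpleReflection) := by
  obtain ⟨F, hpos, -, hF⟩ := exists_invariantForm P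
  by_contra hn
  obtain ⟨i, ⟨hi, hn⟩, hmin⟩ := Set.exists_min_image
    {i | 0 < Δ.height (P.root i) ∧ refl P i ∉ Subgroup.closure (Set.range Δ.simpleReflection)}
    (fun i => Δ.height (P.root i)) (Set.toFinite _) ⟨i, hi, hn⟩
  have hs : F (P.root i) (P.root i)
      = ∑ j : Δ.support, Δ.coord j (P.root i) * F (P.root i) (P.root j) := by
    conv_lhs => rw [show F (P.root i) (P.root i) = F (P.root i)
      (∑ j : Δ.support, Δ.coord j (P.root i) • P.root j) by rw [← Δ.root_eq_sum i]]
    simp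
  obtain ⟨j, -, hj⟩ : ∃ j ∈ Finset.univ,
      0 < Δ.coord j (P.root i) * F (P.root i) (P.root j) := by
    by_contra! H
    exact absurd (hpos i) (not_lt.mpr (hs ▸ Finset.sum_nonpos H))
  have hFj : 0 < F (P.root i) (P.root j) :=
    pos_of_mul_pos_right hj (Δ.coord_nonneg hi j)
  have hc : 0 < P.coroot' j (P.root i) := by
    have h1 := hF j (P.root i)
    have h2 : 0 < P.coroot' j (P.root i) * F (P.root j) (P.root j) := by linarith
    exact pos_of_mul_pos_left h2 (hpos j).le
  have hsj : Δ.simpleReflection j ∈ Subgroup.closure (Set.range Δ.simpleReflection) :=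
    Subgroup.subset_closure ⟨j, rfl⟩
  by_cases hij : P.root i = P.root j
  · rw [P.root.injective hij] at hn
    exact hn hsj
  · have hk := Δ.height_simple_smul_pos hi hij
    have hlt : Δ.height (Δ.simpleReflection j • P.root i) < Δ.height (P.root i) := by
      rw [simpleReflection_eq, refl_smul, map_sub, map_smul, height_simple]
      simpa using hc
    rw [← root_smul] at hk hlt
    have hmem : refl P (Δ.simpleReflection j • i) ∈
        Subgroup.closure (Set.range Δ.simpleReflection) := by
      by_contra hm
      exact absurd (hmin _ ⟨hk, hm⟩) (not_le.mpr hlt)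
    apply hn
    rw [refl_smul_index] at hmem
    have := mul_mem (mul_mem (inv_mem hsj) hmem) hsj
    simpa [mul_assoc] using this

lemma closure_simpleReflection [Finite ι] [P.IsReduced] :
    Subgroup.closure (Set.range Δ.simpleReflection) = ⊤ := by
  rw [eq_top_iff]
  rintro ⟨g, hg⟩ -
  induction hg using RootPairing.weylGroup.induction with
  | mem i =>
    change refl P i ∈ _
    rcases Δ.height_eq_zero_lt_or_lt i with hi | hi
    · exact Δ.refl_mem_closure_of_height_pos i hi
    · have hr : P.root (refl P i • i) = (-1 : ℝ) • P.root i := by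
        rw [root_smul, refl_smul_root_self, neg_one_smul]
      rw [← refl_eq_of_root_eq_smul (by norm_num) hr]
      apply Δ.refl_mem_closure_of_height_pos
      rw [hr, map_smul, smul_eq_mul]
      linarith
  | one => exact one_mem _
  | mul g₁ g₂ hg₁ hg₂ h₁ h₂ => exact mul_mem h₁ h₂

lemma exists_word [Finite ι] [P.IsReduced] (w : P.weylGroup) :
    ∃ l : List Δ.support, (l.map Δ.simpleReflection).prod = w := by
  have hw : w ∈ Subgroup.closure (Set.range Δ.simpleReflection) := by
    rw [closure_simpleReflection]; trivial
  induction hw using Subgroup.closure_induction with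
  | mem x hx => obtain ⟨s, rfl⟩ := hx; exact ⟨[s], by simp⟩
  | one => exact ⟨[], rfl⟩
  | mul x y _ _ hx hy =>
    obtain ⟨l, rfl⟩ := hx
    obtain ⟨l', rfl⟩ := hy
    exact ⟨l ++ l', by simp⟩
  | inv x _ hx =>
    obtain ⟨l, rfl⟩ := hx
    refine ⟨l.reverse, ?_⟩
    rw [List.prod_inv_reverse, List.map_reverse, List.map_map]
    congr 3
    funext s
    simp [simpleReflection_eq]

lemma exists_reduced_word [Finite ι] [P.IsReduced] (w : P.weylGroup) :
    ∃ l : List Δ.support, l.length = Δ.length w ∧ (l.map Δ.simpleReflection).prod = w :=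
  Nat.sInf_mem (s := {k | ∃ l : List Δ.support, l.length = k ∧
    (l.map Δ.simpleReflection).prod = w})
    (let ⟨l, hl⟩ := Δ.exists_word w; ⟨l.length, l, rfl, hl⟩)

lemma length_le (l : List Δ.support) :
    Δ.length (l.map Δ.simpleReflection).prod ≤ l.length :=
  Nat.sInf_le ⟨l, rfl, rfl⟩

lemma length_inv_le [Finite ι] [P.IsReduced] (w : P.weylGroup) :
    Δ.length w⁻¹ ≤ Δ.length w := by
  obtain ⟨l, hl, rfl⟩ := Δ.exists_reduced_word w
  rw [← hl, ← l.length_reverse]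
  convert Δ.length_le l.reverse using 2
  rw [List.prod_inv_reverse, List.map_reverse, List.map_map]
  congr 3
  funext s
  simp [simpleReflection_eq]

@[simp]
lemma length_inv [Finite ι] [P.IsReduced] (w : P.weylGroup) : Δ.length w⁻¹ = Δ.length w :=
  (Δ.length_inv_le w).antisymm (by simpa using Δ.length_inv_le w⁻¹)

/-! ### Strong exchange: length read off from signs of roots. -/

/-- The strong exchange property. -/
lemma exists_shorter_word [Finite ι] [P.IsReduced] {i : ι} (hi : 0 < Δ.height (P.root i))
    (l : List Δ.support) (hl : Δ.height ((l.map Δ.simpleReflection).prod • P.root i) < 0) :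
    ∃ l' : List Δ.support, l'.length < l.length ∧
      (l'.map Δ.simpleReflection).prod = (l.map Δ.simpleReflection).prod * refl P i := by
  induction l with
  | nil => rw [List.map_nil, List.prod_nil, one_smul] at hl; linarith
  | cons s l ih =>
    rw [List.map_cons, List.prod_cons] at hl ⊢
    set w := (l.map Δ.simpleReflection).prod with hw
    rcases Δ.height_eq_zero_lt_or_lt (w • i) with h | h
    -- The sign flips at the letter s, so the root there is the simple root of s, and deleting this
    -- letter multiplies the word by the reflection.
    · have hr : P.root (w • i) = P.root s := by
        by_contra hne
        have := Δ.height_simple_smul_pos h hne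
        rw [root_smul, ← mul_smul] at this
        linarith
      refine ⟨l, by simp, ?_⟩
      rw [mul_assoc, mul_refl_smul_index, P.root.injective hr, simpleReflection_eq,
        refl_mul_refl_mul]
    · rw [root_smul] at h
      obtain ⟨l', h1, h2⟩ := ih h
      refine ⟨s :: l', by simpa using h1, ?_⟩
      rw [List.map_cons, List.prod_cons, h2, mul_assoc]

lemma length_mul_refl_lt_of_height [Finite ι] [P.IsReduced] {i : ι} {w : P.weylGroup}
    (h : Δ.height (P.root i) * Δ.height (w • P.root i) < 0) :
    Δ.length (w * refl P i) < Δ.length w := by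
  wlog hi : 0 < Δ.height (P.root i) generalizing i
  · have hr : P.root (refl P i • i) = (-1 : ℝ) • P.root i := by
      rw [root_smul, refl_smul_root_self, neg_one_smul]
    have hi' := (Δ.height_eq_zero_lt_or_lt i).resolve_left hi
    rw [← refl_eq_of_root_eq_smul (by norm_num) hr]
    apply this
    · rw [hr, smul_smul_real, map_smul, map_smul, smul_eq_mul, smul_eq_mul]
      linarith
    · rw [hr, map_smul, smul_eq_mul]
      linarith
  obtain ⟨l, hl, rfl⟩ := Δ.exists_reduced_word w
  obtain ⟨l', h1, h2⟩ := Δ.exists_shorter_word hi l (by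
    by_contra hn
    exact absurd h (not_lt.mpr (mul_nonneg hi.le (not_lt.mp hn))))
  rw [← h2, ← hl]
  exact (Δ.length_le l').trans_lt h1

/-- Right multiplication by a reflection lengthens `w` exactly when `w` preserves the sign of its
root. -/
lemma length_lt_mul_refl_iff [Finite ι] [P.IsReduced] (i : ι) (w : P.weylGroup) :
    Δ.length w < Δ.length (w * refl P i) ↔
      0 < Δ.height (P.root i) * Δ.height (w • P.root i) := by
  constructor
  · intro h
    by_contra hn
    have h0 := mul_ne_zero (Δ.height_root_ne_zero i) (Δ.height_smul_ne_zero w i)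
    have := Δ.length_mul_refl_lt_of_height (lt_of_le_of_ne (not_lt.mp hn) h0)
    omega
  · intro h
    have := Δ.length_mul_refl_lt_of_height (i := i) (w := w * refl P i) (by
      rw [mul_smul, refl_smul_root_self, smul_neg, map_neg]; linarith)
    rwa [mul_refl_mul_refl] at this

lemma mul_refl_length_lt_iff [Finite ι] [P.IsReduced] (i : ι) (w : P.weylGroup) :
    Δ.length (w * refl P i) < Δ.length w ↔
      Δ.height (P.root i) * Δ.height (w • P.root i) < 0 := by
  refine ⟨fun h => ?_, Δ.length_mul_refl_lt_of_height⟩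
  by_contra hn
  have h0 := mul_ne_zero (Δ.height_root_ne_zero i) (Δ.height_smul_ne_zero w i)
  have := (Δ.length_lt_mul_refl_iff i w).mpr (lt_of_le_of_ne (not_lt.mp hn) h0.symm)
  omega

lemma length_mul_refl_lt_or_lt [Finite ι] [P.IsReduced] (i : ι) (w : P.weylGroup) :
    Δ.length (w * refl P i) < Δ.length w ∨ Δ.length w < Δ.length (w * refl P i) := by
  rw [mul_refl_length_lt_iff, length_lt_mul_refl_iff]
  exact (mul_ne_zero (Δ.height_root_ne_zero i) (Δ.height_smul_ne_zero w i)).lt_or_gt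

lemma mul_pos_of_mul_pos_of_mul_pos {a b c : ℝ} (hb : 0 < a * b) (hc : 0 < a * c) : 0 < b * c := by
  have h : 0 < a ^ 2 * (b * c) := by nlinarith [mul_pos hb hc]
  exact pos_of_mul_pos_right h (sq_nonneg a)

lemma height_mul_simple_smul_pos [Finite ι] [P.IsReduced] (s : Δ.support) {i : ι}
    (hne : refl P i ≠ Δ.simpleReflection s) :
    0 < Δ.height (P.root i) * Δ.height (Δ.simpleReflection s • P.root i) := by
  rcases Δ.height_eq_zero_lt_or_lt i with hi | hi
  · refine mul_pos hi (Δ.height_simple_smul_pos hi fun h => hne ?_)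
    rw [P.root.injective h]; rfl
  · have hr : P.root (refl P i • i) = (-1 : ℝ) • P.root i := by
      rw [root_smul, refl_smul_root_self, neg_one_smul]
    have h1 : 0 < Δ.height (P.root (refl P i • i)) := by
      rw [hr, map_smul, smul_eq_mul]; linarith
    have h2 := Δ.height_simple_smul_pos (s := s) h1 fun h => hne (by
      rw [← refl_eq_of_root_eq_smul (by norm_num) hr, P.root.injective h]; rfl)
    rw [hr, smul_smul_real, map_smul, smul_eq_mul] at h2
    exact mul_pos_of_neg_of_neg hi (by linarith)

lemma simple_inv (s : Δ.support) : (Δ.simpleReflection s)⁻¹ = Δ.simpleReflection s :=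
  refl_inv P s

lemma mul_simple_mul_simple (w : P.weylGroup) (s : Δ.support) :
    w * Δ.simpleReflection s * Δ.simpleReflection s = w :=
  mul_refl_mul_refl P w s

lemma simple_mul_simple_mul (w : P.weylGroup) (s : Δ.support) :
    Δ.simpleReflection s * (Δ.simpleReflection s * w) = w :=
  refl_mul_refl_mul P w s

/-! ### Bruhat order and the lifting property. -/

namespace BruhatLE

variable {Δ} {x y z : P.weylGroup}

protected lemma refl (x : P.weylGroup) : Δ.BruhatLE x x := Relation.ReflTransGen.refl

protected lemma trans (h : Δ.BruhatLE x y) (h' : Δ.BruhatLE y z) : Δ.BruhatLE x z :=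
  Relation.ReflTransGen.trans h h'

lemma of_length_lt {i : ι} (h : Δ.length x < Δ.length (x * refl P i)) :
    Δ.BruhatLE x (x * refl P i) :=
  Relation.ReflTransGen.single ⟨i, rfl, h⟩

lemma of_length_lt_mul_simple {s : Δ.support}
    (h : Δ.length x < Δ.length (x * Δ.simpleReflection s)) :
    Δ.BruhatLE x (x * Δ.simpleReflection s) :=
  of_length_lt h

lemma of_mul_simple_length_lt {s : Δ.support}
    (h : Δ.length (x * Δ.simpleReflection s) < Δ.length x) :
    Δ.BruhatLE (x * Δ.simpleReflection s) x := by
  have := of_length_lt_mul_simple (x := x * Δ.simpleReflection s) (s := s)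
    (by rwa [mul_simple_mul_simple])
  rwa [mul_simple_mul_simple] at this

lemma length_le (h : Δ.BruhatLE x y) : Δ.length x ≤ Δ.length y := by
  induction h with
  | refl => exact le_rfl
  | tail _ h ih => obtain ⟨i, -, hl⟩ := h; exact ih.trans hl.le

lemma eq_of_length_le (h : Δ.BruhatLE x y) (hl : Δ.length y ≤ Δ.length x) : x = y := by
  rcases Relation.ReflTransGen.cases_head h with h | ⟨z, ⟨i, -, hz⟩, hzy⟩
  · exact h
  · exact absurd (length_le hzy) (by omega)

variable [Finite ι] [P.IsReduced]

/-- A step x < x·r inverts to a step by the conjugate reflection, because length is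
inversion-invariant. -/
protected lemma inv (h : Δ.BruhatLE x y) : Δ.BruhatLE x⁻¹ y⁻¹ := by
  induction h with
  | refl => exact .refl _
  | @tail b c _ h ih =>
    obtain ⟨i, rfl, hl⟩ := h
    refine ih.trans ?_
    have he : (b * refl P i)⁻¹ = b⁻¹ * refl P (b • i) := by
      rw [refl_smul_index, mul_inv_rev, refl_inv]; group
    have hl' : Δ.length b⁻¹ < Δ.length (b⁻¹ * refl P (b • i)) := by
      rw [← he, length_inv, length_inv]; exact hl
    change Δ.BruhatLE b⁻¹ (b * refl P i)⁻¹
    rw [he]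
    exact of_length_lt hl'

/-- A simple reflection preserves the sign of every root but its own and its negative, so
conjugating the step by s keeps it an ascent. -/
lemma mul_simple_of_step {i : ι} (h : Δ.length x < Δ.length (x * refl P i)) (s : Δ.support) :
    refl P i = Δ.simpleReflection s ∨
      Δ.BruhatLE (x * Δ.simpleReflection s) (x * refl P i * Δ.simpleReflection s) := by
  by_cases hs : refl P i = Δ.simpleReflection s
  · exact Or.inl hs
  right
  have he : x * refl P i * Δ.simpleReflection s =
      x * Δ.simpleReflection s * refl P (Δ.simpleReflection s • i) := by
    rw [refl_smul_index, simple_inv, mul_assoc, mul_assoc, mul_assoc, simple_mul_simple_mul]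
  rw [he]
  apply of_length_lt
  rw [length_lt_mul_refl_iff] at h ⊢
  rw [root_smul, ← mul_smul, mul_simple_mul_simple]
  exact mul_pos_of_mul_pos_of_mul_pos (Δ.height_mul_simple_smul_pos s hs) h

lemma mul_simple_le_or (h : Δ.BruhatLE x y) (s : Δ.support) :
    Δ.BruhatLE (x * Δ.simpleReflection s) y ∨
      Δ.BruhatLE (x * Δ.simpleReflection s) (y * Δ.simpleReflection s) := by
  induction h with
  | refl => exact Or.inr (.refl _)
  | @tail b c _ h ih =>
    obtain ⟨i, rfl, hl⟩ := h
    rcases ih with ih | ih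
    · exact Or.inl (ih.trans (of_length_lt hl))
    · rcases mul_simple_of_step hl s with he | he
      · left; change Δ.BruhatLE _ (b * refl P i); rwa [he]
      · exact Or.inr (ih.trans he)

lemma le_mul_simple_or (h : Δ.BruhatLE x y) (s : Δ.support) :
    Δ.BruhatLE x (y * Δ.simpleReflection s) ∨
      Δ.BruhatLE (x * Δ.simpleReflection s) (y * Δ.simpleReflection s) := by
  induction h using Relation.ReflTransGen.head_induction_on with
  | refl => exact Or.inr (.refl _)
  | @head a c h _ ih =>
    obtain ⟨i, rfl, hl⟩ := h
    rcases ih with ih | ih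
    · exact Or.inl ((of_length_lt hl).trans ih)
    · rcases mul_simple_of_step hl s with he | he
      · left
        change Δ.BruhatLE (a * refl P i * _) _ at ih
        rwa [he, mul_simple_mul_simple] at ih
      · exact Or.inr (he.trans ih)

lemma mul_simple_mul_simple_of_lt (h : Δ.BruhatLE x y) {s : Δ.support}
    (hy : Δ.length y < Δ.length (y * Δ.simpleReflection s)) :
    Δ.BruhatLE (x * Δ.simpleReflection s) (y * Δ.simpleReflection s) :=
  (h.mul_simple_le_or s).elim (fun h => h.trans (of_length_lt_mul_simple hy)) id

lemma mul_simple_le_of_lt (h : Δ.BruhatLE x y) {s : Δ.support}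
    (hy : Δ.length (y * Δ.simpleReflection s) < Δ.length y) :
    Δ.BruhatLE (x * Δ.simpleReflection s) y :=
  (h.mul_simple_le_or s).elim id (fun h => h.trans (of_mul_simple_length_lt hy))

lemma mul_simple_mul_simple_of_gt (h : Δ.BruhatLE x y) {s : Δ.support}
    (hx : Δ.length (x * Δ.simpleReflection s) < Δ.length x) :
    Δ.BruhatLE (x * Δ.simpleReflection s) (y * Δ.simpleReflection s) :=
  (h.le_mul_simple_or s).elim (fun h => (of_mul_simple_length_lt hx).trans h) id

lemma le_mul_simple_of_gt (h : Δ.BruhatLE x y) {s : Δ.support}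
    (hx : Δ.length x < Δ.length (x * Δ.simpleReflection s)) :
    Δ.BruhatLE x (y * Δ.simpleReflection s) :=
  (h.le_mul_simple_or s).elim id (fun h => (of_length_lt_mul_simple hx).trans h)

lemma of_inv (h : Δ.BruhatLE x⁻¹ y⁻¹) : Δ.BruhatLE x y := by simpa using h.inv

end BruhatLE

variable [Finite ι] [P.IsReduced]

/-- The word need not be reduced: every simple reflection lengthens 1, so lifting keeps 1 below
after each letter. -/
lemma one_bruhatLE (w : P.weylGroup) : Δ.BruhatLE 1 w := by
  obtain ⟨l, rfl⟩ := Δ.exists_word w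
  induction l using List.reverseRecOn with
  | nil => exact .refl 1
  | append_singleton l s ih =>
    rw [List.map_append, List.prod_append, List.map_singleton, List.prod_singleton]
    apply ih.le_mul_simple_of_gt
    rw [simpleReflection_eq, length_lt_mul_refl_iff, one_smul, height_simple]
    norm_num

/-! ### Left translates of upper Bruhat intervals. -/

lemma length_simple_mul (s : Δ.support) (w : P.weylGroup) :
    Δ.length (Δ.simpleReflection s * w) = Δ.length (w⁻¹ * Δ.simpleReflection s) := by
  rw [← length_inv, mul_inv_rev, simple_inv]

/-- If `s u > u`, the elements above `u` are the elements above `s u` and their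
left translates by `s`. -/
lemma bruhatLE_iff_of_length_lt_simple_mul {u : P.weylGroup} {s : Δ.support}
    (hu : Δ.length u < Δ.length (Δ.simpleReflection s * u)) (v : P.weylGroup) :
    Δ.BruhatLE u v ↔ Δ.BruhatLE (Δ.simpleReflection s * u) v ∨
      Δ.BruhatLE (Δ.simpleReflection s * u) (Δ.simpleReflection s * v) := by
  have hu' : Δ.length u⁻¹ < Δ.length (u⁻¹ * Δ.simpleReflection s) := by
    rwa [← length_simple_mul, length_inv]
  have hinv (w : P.weylGroup) : (Δ.simpleReflection s * w)⁻¹ = w⁻¹ * Δ.simpleReflection s := by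
    rw [mul_inv_rev, simple_inv]
  constructor
  · intro h
    rcases Δ.length_mul_refl_lt_or_lt s v⁻¹ with hv | hv
    · left
      apply BruhatLE.of_inv
      rw [hinv]
      exact h.inv.mul_simple_le_of_lt hv
    · right
      apply BruhatLE.of_inv
      rw [hinv, hinv]
      exact h.inv.mul_simple_mul_simple_of_lt hv
  · have hle : Δ.BruhatLE u (Δ.simpleReflection s * u) := by
      apply BruhatLE.of_inv
      rw [hinv]
      exact BruhatLE.of_length_lt_mul_simple hu'
    rintro (h | h)
    · exact hle.trans h
    · have h1 := h.inv
      rw [hinv, hinv] at h1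
      have h2 := h1.mul_simple_mul_simple_of_gt (s := s) (by rwa [mul_simple_mul_simple])
      rw [mul_simple_mul_simple, mul_simple_mul_simple] at h2
      exact h2.of_inv

/-- An element which every simple reflection shortens is maximal in the Bruhat order. -/
lemma eq_of_bruhatLE_of_forall_simple_mul_lt {u v : P.weylGroup}
    (hu : ∀ s, Δ.length (Δ.simpleReflection s * u) < Δ.length u) (h : Δ.BruhatLE u v) :
    u = v := by
  have hs : ∀ s : Δ.support, Δ.height (u⁻¹ • P.root s) < 0 := by
    intro s
    have h1 := hu s
    rw [length_simple_mul, ← Δ.length_inv u, simpleReflection_eq, mul_refl_length_lt_iff,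
      height_simple, one_mul] at h1
    exact h1
  -- Since u⁻¹ makes all simple roots negative, it flips the sign of every root; hence no reflection
  -- lengthens u.
  have hneg : ∀ i, Δ.height (P.root i) * Δ.height (u⁻¹ • P.root i) < 0 := by
    intro i
    have hsum : Δ.height (u⁻¹ • P.root i)
        = ∑ j : Δ.support, Δ.coord j (P.root i) * Δ.height (u⁻¹ • P.root j) := by
      conv_lhs => rw [Δ.root_eq_sum i]
      simp [Finset.smul_sum, smul_smul_real]
    apply lt_of_le_of_ne _ (mul_ne_zero (Δ.height_root_ne_zero i) (Δ.height_smul_ne_zero _ i))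
    rw [hsum, height_root]
    rcases Δ.coord_nonneg_or_nonpos i with hc | hc
    · exact mul_nonpos_of_nonneg_of_nonpos (Finset.sum_nonneg fun j _ => hc j)
        (Finset.sum_nonpos fun j _ => mul_nonpos_of_nonneg_of_nonpos (hc j) (hs j).le)
    · exact mul_nonpos_of_nonpos_of_nonneg (Finset.sum_nonpos fun j _ => hc j)
        (Finset.sum_nonneg fun j _ => mul_nonneg_of_nonpos_of_nonpos (hc j) (hs j).le)
  rcases Relation.ReflTransGen.cases_head h with h | ⟨z, ⟨i, rfl, hz⟩, -⟩
  · exact h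
  · rw [length_lt_mul_refl_iff] at hz
    have := hneg (u • i)
    rw [root_smul, inv_smul_smul] at this
    linarith

/-- Left translation of an upper Bruhat interval is antitone in the translating element. -/
lemma exists_mul_bruhatLE_mul {a b : P.weylGroup} (hab : Δ.BruhatLE a b) {u v : P.weylGroup}
    (huv : Δ.BruhatLE u v) : ∃ v', Δ.BruhatLE u v' ∧ Δ.BruhatLE (b * v') (a * v) := by
  induction hab generalizing v with
  | refl => exact ⟨v, huv, .refl _⟩
  | @tail a b _ h ih =>
    obtain ⟨v, huv, hle⟩ := ih huv
    obtain ⟨i, rfl, hl⟩ := h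
    suffices ∃ v', Δ.BruhatLE u v' ∧ Δ.BruhatLE (a * refl P i * v') (a * v) by
      obtain ⟨v', h1, h2⟩ := this
      exact ⟨v', h1, h2.trans hle⟩
    have he (w : P.weylGroup) : refl P i * w = w * refl P (w⁻¹ • i) := by
      rw [refl_smul_index]; group
    -- Write r for the reflection and rv = vr'. If vr' < v, then ar > a forces avr' < av, so v' = v
    -- works. If vr' > v, then v' = vr' gives arv' = av.
    rcases Δ.length_mul_refl_lt_or_lt (v⁻¹ • i) v with hv | hv
    · refine ⟨v, huv, ?_⟩
      rw [mul_assoc, he, ← mul_assoc]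
      have : Δ.length (a * v * refl P (v⁻¹ • i)) < Δ.length (a * v) := by
        rw [mul_refl_length_lt_iff, root_smul, mul_smul, smul_inv_smul] at *
        rw [length_lt_mul_refl_iff] at hl
        by_contra hn
        have h0 : Δ.height (v⁻¹ • P.root i) * Δ.height (a • P.root i) ≠ 0 :=
          mul_ne_zero (Δ.height_smul_ne_zero _ i) (Δ.height_smul_ne_zero _ i)
        have h1 := lt_of_le_of_ne (not_lt.mp hn) h0.symm
        have h2 := mul_pos_of_mul_pos_of_mul_pos
          (by rwa [mul_comm] at h1) (by rwa [mul_comm] at hl)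
        linarith
      have h2 := BruhatLE.of_length_lt (Δ := Δ) (x := a * v * refl P (v⁻¹ • i)) (i := v⁻¹ • i)
        (by rwa [mul_refl_mul_refl])
      rwa [mul_refl_mul_refl] at h2
    · refine ⟨v * refl P (v⁻¹ • i), huv.trans (.of_length_lt hv), ?_⟩
      rw [← he, mul_assoc, refl_mul_refl_mul]
      exact .refl _

/-- Every left translate of an upper Bruhat interval has a least element. -/
lemma exists_least_mul [P.IsRootSystem] (u a : P.weylGroup) :
    ∃ d, Δ.BruhatLE u d ∧ ∀ v, Δ.BruhatLE u v → Δ.BruhatLE (a * d) (a * v) := by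
  obtain ⟨K, hK⟩ : ∃ K, ∀ w, Δ.length w ≤ K := by
    obtain ⟨K, hK⟩ := (Set.finite_range Δ.length).bddAbove
    exact ⟨K, fun w => hK ⟨w, rfl⟩⟩
  -- The translating element varies too, because the step needs both a and a·s.
  induction hn : K - Δ.length u using Nat.strong_induction_on generalizing u a with
  | _ n ih =>
  by_cases hs : ∀ s, Δ.length (Δ.simpleReflection s * u) < Δ.length u
  · refine ⟨u, .refl u, fun v hv => ?_⟩
    rw [Δ.eq_of_bruhatLE_of_forall_simple_mul_lt hs hv]
    exact .refl _
  · push Not at hs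
    obtain ⟨s, hs⟩ := hs
    have hlt : Δ.length u < Δ.length (Δ.simpleReflection s * u) := by
      rw [length_simple_mul, ← Δ.length_inv u] at hs ⊢
      exact (Δ.length_mul_refl_lt_or_lt s u⁻¹).resolve_left (not_lt.mpr hs)
    have hup := Δ.bruhatLE_iff_of_length_lt_simple_mul hlt
    have hK' := hK (Δ.simpleReflection s * u)
    obtain ⟨d, hd, hmin⟩ := ih _ (by omega) (Δ.simpleReflection s * u) a rfl
    obtain ⟨d', hd', hmin'⟩ := ih _ (by omega) (Δ.simpleReflection s * u)
      (a * Δ.simpleReflection s) rfl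
    -- The longer of a and a·s supplies the least element; anything in the other translate dominates
    -- something in this one.
    rcases Δ.length_mul_refl_lt_or_lt s a with ha | ha
    · refine ⟨d, (hup d).mpr (Or.inl hd), fun v hv => ?_⟩
      rcases (hup v).mp hv with hv | hv
      · exact hmin v hv
      · obtain ⟨v', h1, h2⟩ := Δ.exists_mul_bruhatLE_mul
          (BruhatLE.of_mul_simple_length_lt ha) hv
        rw [mul_assoc, simple_mul_simple_mul] at h2
        exact (hmin v' h1).trans h2
    · refine ⟨Δ.simpleReflection s * d', (hup _).mpr (Or.inr (by rwa [simple_mul_simple_mul])),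
        fun v hv => ?_⟩
      rw [← mul_assoc]
      rcases (hup v).mp hv with hv | hv
      · obtain ⟨v', h1, h2⟩ := Δ.exists_mul_bruhatLE_mul
          (BruhatLE.of_length_lt_mul_simple ha) hv
        exact (hmin' v' h1).trans h2
      · have := hmin' _ hv
        rwa [mul_assoc a _ (Δ.simpleReflection s * v), simple_mul_simple_mul] at this

/-! ### Passage to cosets. -/

variable {I : Set Δ.support}

/-- Each coset has a representative `m` such that the set of elements above `m` is a union of
cosets. -/
lemma exists_coset_rep (B : Δ.Cosets I) : ∃ m : P.weylGroup, (m : Δ.Cosets I) = B ∧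
    ∀ x y : P.weylGroup, Δ.BruhatLE m x → (x : Δ.Cosets I) = y → Δ.BruhatLE m y := by
  obtain ⟨m, hm, hmin⟩ := (measure Δ.length).wf.has_min
    {m : P.weylGroup | (m : Δ.Cosets I) = B} (QuotientGroup.mk_surjective B)
  refine ⟨m, hm, fun x y hx hxy => ?_⟩
  -- As m is shortest in its coset, no s in I shortens it; lifting then preserves being above m.
  have hms : ∀ s ∈ I, Δ.length m < Δ.length (m * Δ.simpleReflection s) := by
    intro s hs
    have hmem : ((m * Δ.simpleReflection s : P.weylGroup) : Δ.Cosets I) = B := by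
      rw [← hm]
      exact QuotientGroup.mk_mul_of_mem m (Subgroup.subset_closure ⟨s, hs, rfl⟩)
    exact (Δ.length_mul_refl_lt_or_lt s m).resolve_left (hmin _ hmem)
  have key : ∀ g ∈ Δ.parabolic I, ∀ x, Δ.BruhatLE m x → Δ.BruhatLE m (x * g) := by
    intro g hg
    induction hg using Subgroup.closure_induction_right with
    | one => intro x hx; rwa [mul_one]
    | mul_right g _ y hy ih =>
      obtain ⟨s, hs, rfl⟩ := hy
      intro x hx
      rw [← mul_assoc]
      exact (ih x hx).le_mul_simple_of_gt (hms s hs)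
    | mul_inv_cancel g _ y hy ih =>
      obtain ⟨s, hs, rfl⟩ := hy
      intro x hx
      rw [← mul_assoc, simple_inv]
      exact (ih x hx).le_mul_simple_of_gt (hms s hs)
  have := key _ (QuotientGroup.eq.mp hxy) x hx
  rwa [mul_inv_cancel_left] at this

/-- Replaces the doubly existential coset order by a comparison with one fixed m, valid for any
representative x. -/
lemma exists_bruhatLE_rep (B : Δ.Cosets I) : ∃ m : P.weylGroup, (m : Δ.Cosets I) = B ∧
    ∀ x : P.weylGroup, Δ.CosetLE B x ↔ Δ.BruhatLE m x := by
  obtain ⟨m, hm, h⟩ := Δ.exists_coset_rep B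
  refine ⟨m, hm, fun x => ⟨?_, fun hx => ⟨m, x, hm, rfl, hx⟩⟩⟩
  rintro ⟨u, u', rfl, hu', hle⟩
  exact h u' x ((h m u (.refl m) hm).trans hle) hu'

variable {Δ} in
lemma CosetLE.antisymm {B B' : Δ.Cosets I} (h : Δ.CosetLE B B') (h' : Δ.CosetLE B' B) :
    B = B' := by
  obtain ⟨m, rfl, hm⟩ := Δ.exists_bruhatLE_rep B
  obtain ⟨m', rfl, hm'⟩ := Δ.exists_bruhatLE_rep B'
  rw [(hm m').mp h |>.eq_of_length_le ((hm' m).mp h').length_le]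

/-- The least element of a Coxeter Schubert matroid in a twisted order. -/
lemma exists_forall_isMinimalIn_schubert_iff [P.IsRootSystem] (B : Δ.Cosets I) (w : P.weylGroup) :
    ∃ D : Δ.Cosets I, Δ.CosetLE (w⁻¹ • D) B ∧
      ∀ D', Δ.IsMinimalIn w (Δ.schubert B) D' ↔ D' = D := by
  obtain ⟨m, hm, hle⟩ := Δ.exists_bruhatLE_rep B
  obtain ⟨d, hd, hmin⟩ := Δ.exists_least_mul m w⁻¹
  have hmem : (d : Δ.Cosets I) ∈ Δ.schubert B := (hle d).mpr hd
  have hleast : ∀ B' ∈ Δ.schubert B, Δ.CosetLETwist w (d : Δ.Cosets I) B' := by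
    intro B' hB'
    obtain ⟨v, rfl⟩ := QuotientGroup.mk_surjective B'
    exact ⟨w⁻¹ * d, w⁻¹ * v, rfl, rfl, hmin v ((hle v).mp hB')⟩
  have hanti : ∀ B₁ B₂ : Δ.Cosets I, Δ.CosetLETwist w B₁ B₂ → Δ.CosetLETwist w B₂ B₁ →
      B₁ = B₂ := fun B₁ B₂ h₁ h₂ => smul_left_cancel _ (h₁.antisymm h₂)
  refine ⟨d, ?_, fun D' => ⟨fun h => (h.2 _ hmem (hleast D' h.1)).symm, ?_⟩⟩
  -- Some v' ≥ m has w⁻¹v' ≤ m, and w⁻¹d lies below w⁻¹v'.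
  · obtain ⟨v', h1, h2⟩ := Δ.exists_mul_bruhatLE_mul (Δ.one_bruhatLE w⁻¹) (BruhatLE.refl (Δ := Δ) m)
    rw [one_mul] at h2
    exact ⟨w⁻¹ * d, m, rfl, hm, (hmin v' h1).trans h2⟩
  · rintro rfl
    exact ⟨hmem, fun B' hB' h => hanti _ _ h (hleast B' hB')⟩

end SimpleSystem

end CoxeterSchubert

end

theorem mainTheorem8 {ι V N : Type*} [Finite ι] [AddCommGroup V] [Module ℝ V]
    [AddCommGroup N] [Module ℝ N] (P : RootPairing ι ℝ V N) [P.IsRootSystem] [P.IsReduced]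
    (Δ : CoxeterSchubert.SimpleSystem P) (I : Set Δ.support) (B : Δ.Cosets I) :
    ∃ hB : Δ.IsCoxeterMatroid (Δ.schubert B),
      (∃ c : Δ.Cosets I → ℚ,
        (Δ.gInvariant hB = ∑ B' ∈ Δ.lowerCosets B, c B' • Δ.basisVec B') ∧ c B ≠ 0) ∧
      ∀ w : P.weylGroup, Δ.CosetLE (w⁻¹ • Δ.minElt hB w) B := by
  classical
  have hB : Δ.IsCoxeterMatroid (Δ.schubert B) := fun w => by
    obtain ⟨D, -, hD⟩ := Δ.exists_forall_isMinimalIn_schubert_iff B w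
    exact ⟨D, (hD D).mpr rfl, fun D' h => (hD D').mp h⟩
  have hle : ∀ w : P.weylGroup, Δ.CosetLE (w⁻¹ • Δ.minElt hB w) B := fun w => by
    obtain ⟨D, hDB, hD⟩ := Δ.exists_forall_isMinimalIn_schubert_iff B w
    have h : Δ.minElt hB w = D := (hD _).mp (hB w).choose_spec.1
    rwa [h]
  -- For w = 1 the minimum is below B by `hle` and above B by membership in Ω_B.
  have hone : Δ.minElt hB 1 = B := by
    have h1 := (hB 1).choose_spec.1
    have h2 : Δ.CosetLE (Δ.minElt hB 1) B := by simpa using hle 1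
    exact h2.antisymm h1.1
  -- The invariant is its own coefficient function; it vanishes off the cosets below B.
  refine ⟨hB, ⟨Δ.gInvariant hB, ?_, ?_⟩, hle⟩
  · funext C
    simp only [Finset.sum_apply, Pi.smul_apply, CoxeterSchubert.SimpleSystem.basisVec,
      Pi.single_apply, smul_eq_mul, mul_ite, mul_one, mul_zero, Finset.sum_ite_eq]
    split_ifs with hC
    · rfl
    · rw [CoxeterSchubert.SimpleSystem.gInvariant, Finset.sum_apply]
      refine Finset.sum_eq_zero fun w _ => ?_
      rw [CoxeterSchubert.SimpleSystem.basisVec, Pi.single_apply, if_neg]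
      rintro rfl
      exact hC (by simpa [CoxeterSchubert.SimpleSystem.lowerCosets] using hle w)
  · rw [CoxeterSchubert.SimpleSystem.gInvariant, Finset.sum_apply]
    apply ne_of_gt
    refine Finset.sum_pos' (fun w _ => ?_) ⟨1, Finset.mem_univ _, ?_⟩
    · rw [CoxeterSchubert.SimpleSystem.basisVec, Pi.single_apply]
      split_ifs <;> norm_num
    · simp [CoxeterSchubert.SimpleSystem.basisVec, hone]
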